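/- Let $L$ be a Lie ring, that is, a Lie algebra over $\mathbb Z$. Let $U(L)$ be its universal enveloping algebra over $\mathbb Z$, with canonical map $\iota\colon L\to U(L)$, let $\varpi(L)$ be the augmentation ideal of $U(L)$, i.e. the two-sided ideal generated by $\iota(L)$, and for $n\ge 1$ let $\delta_n(L)=L\cap\varpi(L)^n=\{x\in L:\iota(x)\in\varpi(L)^n\}$ be the $n$th Lie dimension subring of $L$. Let $\gamma_1(L)=L$, $\gamma_{n+1}(L)=[L,\gamma_n(L)]$ be the lower central series, and let $L''=[[L,L],[L,L]]$ be the second derived subring. Then $$[\delta_4(L),L]\subseteq\gamma_5(L)+L''.$$ In particular, if $L$ is metabelian (i.e. $L''=0$), then $\gamma_5(L)\subseteq\delta_4(L)$ and $\delta_4(L)/\gamma_5(L)$ is central in the Lie ring $L/\gamma_5(L)$. -/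

import Mathlib

/-- The augmentation ideal `ϖ(L)`: the two-sided ideal of the universal enveloping algebra `U(L)`
generated by the image of the canonical map `ι : L → U(L)`. -/
def lieAugmentationIdeal (R L : Type*) [CommRing R] [LieRing L] [LieAlgebra R L] :
    Ideal (UniversalEnvelopingAlgebra R L) :=
  (TwoSidedIdeal.span (Set.range (UniversalEnvelopingAlgebra.ι R : L → _))).asIdeal

instance lieAugmentationIdeal_isTwoSided (R L : Type*) [CommRing R] [LieRing L]
    [LieAlgebra R L] : (lieAugmentationIdeal R L).IsTwoSided := by
  unfold lieAugmentationIdeal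
  infer_instance

section

attribute [local instance 100] LieRing.ofAssociativeRing

/-- The `n`-th Lie dimension subring `δ_n(L) = L ∩ ϖ(L)^n`, that is, the set of all `x` in `L`
whose image in `U(L)` lies in the `n`-th power of the augmentation ideal. It is a Lie ideal. -/
def lieDimensionSubring (R L : Type*) [CommRing R] [LieRing L] [LieAlgebra R L] (n : ℕ) :
    LieIdeal R L where
  carrier := {x | UniversalEnvelopingAlgebra.ι R x ∈ lieAugmentationIdeal R L ^ n}
  add_mem' {x y} hx hy := by
    simp only [Set.mem_ofPred_eq] at hx hy ⊢
    rw [map_add]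
    exact add_mem hx hy
  zero_mem' := by
    simp only [Set.mem_ofPred_eq]
    rw [map_zero]
    exact zero_mem _
  smul_mem' c x hx := by
    simp only [Set.mem_ofPred_eq] at hx ⊢
    rw [map_smul, Algebra.smul_def]
    exact Ideal.mul_mem_left _ _ hx
  lie_mem {x m} hm := by
    change UniversalEnvelopingAlgebra.ι R m ∈ lieAugmentationIdeal R L ^ n at hm
    change UniversalEnvelopingAlgebra.ι R ⁅x, m⁆ ∈ lieAugmentationIdeal R L ^ n
    rw [LieHom.map_lie, LieRing.of_associative_ring_bracket]
    exact sub_mem (Ideal.mul_mem_left _ _ hm) (Ideal.mul_mem_right _ _ hm)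

end

/-- The lower central series numbered from one, by Lie ideals: `γ_1(L) = L` and
`γ_{n+1}(L) = [L, γ_n(L)]`. (The value at `n = 0` is `L`, too, and plays no role.) -/
def lieGamma (R L : Type*) [CommRing R] [LieRing L] [LieAlgebra R L] (n : ℕ) : LieIdeal R L :=
  LieModule.lowerCentralSeries R L L (n - 1)

section

attribute [local instance 100] LieRing.ofAssociativeRing

/-! The adjoint action of $L$ extends to $U(L)$, and each factor from $\varpi(L)$ moves one step
down the lower central series. Hence $u\in\varpi(L)^n$ sends $L=\gamma_1(L)$ into $\gamma_{n+1}(L)$.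
For $u=\iota(x)$ with $x\in\delta_n(L)$ this gives $[\delta_n(L),L]\subseteq\gamma_{n+1}(L)$, so
$[\delta_4(L),L]$ already lies in $\gamma_5(L)$. -/

theorem UniversalEnvelopingAlgebra.adjoin_range_ι (R L : Type*) [CommRing R] [LieRing L]
    [LieAlgebra R L] :
    Algebra.adjoin R (Set.range (UniversalEnvelopingAlgebra.ι R : L → _)) = ⊤ := by
  set S := Algebra.adjoin R (Set.range (UniversalEnvelopingAlgebra.ι R : L → _)) with hS
  have hmem (x : L) : UniversalEnvelopingAlgebra.ι R x ∈ S := Algebra.subset_adjoin ⟨x, rfl⟩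
  let f : L →ₗ⁅R⁆ S :=
    { toFun := fun x ↦ ⟨UniversalEnvelopingAlgebra.ι R x, hmem x⟩
      map_add' := fun x y ↦ Subtype.ext (map_add _ x y)
      map_smul' := fun c x ↦ Subtype.ext (map_smul _ c x)
      map_lie' := fun {x y} ↦ Subtype.ext (LieHom.map_lie _ x y) }
  -- By the universal property, lifting the corestriction of `ι` to `S` and then including is the
  -- identity, so every element lies in `S`.
  have hid : S.val.comp (UniversalEnvelopingAlgebra.lift R f) = AlgHom.id R _ := by
    apply UniversalEnvelopingAlgebra.hom_ext
    ext x
    change S.val (UniversalEnvelopingAlgebra.lift R f (UniversalEnvelopingAlgebra.ι R x)) = _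
    rw [UniversalEnvelopingAlgebra.lift_ι_apply]
    rfl
  refine eq_top_iff.2 fun u _ ↦ ?_
  rw [← AlgHom.id_apply (R := R) u, ← hid]
  exact (UniversalEnvelopingAlgebra.lift R f u).2

variable (R L M : Type*) [CommRing R] [LieRing L] [LieAlgebra R L] [AddCommGroup M] [Module R M]
  [LieRingModule L M] [LieModule R L M]

/-- The action on a Lie module extended to the universal enveloping algebra. -/
noncomputable def LieModule.envelopingAction :
    UniversalEnvelopingAlgebra R L →ₐ[R] Module.End R M :=
  UniversalEnvelopingAlgebra.lift R (LieModule.toEnd R L M)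

@[simp] theorem LieModule.envelopingAction_ι (x : L) (m : M) :
    LieModule.envelopingAction R L M (UniversalEnvelopingAlgebra.ι R x) m = ⁅x, m⁆ := by
  rw [LieModule.envelopingAction, UniversalEnvelopingAlgebra.lift_ι_apply]
  rfl

variable {R L M}

theorem LieSubmodule.envelopingAction_mem (N : LieSubmodule R L M)
    (u : UniversalEnvelopingAlgebra R L) {m : M} (hm : m ∈ N) :
    LieModule.envelopingAction R L M u m ∈ N := by
  have hu : u ∈ Algebra.adjoin R (Set.range (UniversalEnvelopingAlgebra.ι R : L → _)) := by
    rw [UniversalEnvelopingAlgebra.adjoin_range_ι]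
    trivial
  induction hu using Algebra.adjoin_induction generalizing m with
  | mem u hu =>
    obtain ⟨x, rfl⟩ := hu
    rw [LieModule.envelopingAction_ι]
    exact N.lie_mem hm
  | algebraMap r =>
    rw [AlgHom.commutes, Module.algebraMap_end_apply]
    exact N.smul_mem r hm
  | add u v _ _ hu hv =>
    rw [map_add, LinearMap.add_apply]
    exact add_mem (hu hm) (hv hm)
  | mul u v _ _ hu hv =>
    rw [map_mul, Module.End.mul_apply]
    exact hu (hv hm)

/-- A generator `ι x` acts as a bracket. Left multiples stay inside because `⁅⊤, N⁆` is stable under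
$U(L)$, right multiples because `N` is. -/
theorem LieSubmodule.envelopingAction_mem_lie (N : LieSubmodule R L M)
    {u : UniversalEnvelopingAlgebra R L} (hu : u ∈ lieAugmentationIdeal R L) {m : M}
    (hm : m ∈ N) :
    LieModule.envelopingAction R L M u m ∈ ⁅(⊤ : LieIdeal R L), N⁆ := by
  rw [lieAugmentationIdeal, TwoSidedIdeal.mem_asIdeal] at hu
  induction hu using TwoSidedIdeal.span_induction generalizing m with
  | mem u hu =>
    obtain ⟨x, rfl⟩ := hu
    rw [LieModule.envelopingAction_ι]
    exact LieSubmodule.lie_mem_lie (LieSubmodule.mem_top x) hm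
  | zero => simp
  | add u v _ _ hu hv =>
    rw [map_add, LinearMap.add_apply]
    exact add_mem (hu hm) (hv hm)
  | neg u _ hu =>
    rw [map_neg, LinearMap.neg_apply]
    exact neg_mem (hu hm)
  | left_absorb a u _ hu =>
    rw [map_mul, Module.End.mul_apply]
    exact LieSubmodule.envelopingAction_mem _ a (hu hm)
  | right_absorb b u _ hu =>
    rw [map_mul, Module.End.mul_apply]
    exact hu (LieSubmodule.envelopingAction_mem _ b hm)

theorem LieModule.envelopingAction_mem_lowerCentralSeries (n : ℕ)
    {u : UniversalEnvelopingAlgebra R L} (hu : u ∈ lieAugmentationIdeal R L ^ n) (m : M) :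
    LieModule.envelopingAction R L M u m ∈ LieModule.lowerCentralSeries R L M n := by
  induction n generalizing u with
  | zero => simp
  | succ n ih =>
    rw [Ideal.IsTwoSided.pow_succ] at hu
    induction hu using Submodule.mul_induction_on' with
    | mem_mul_mem a ha b hb =>
      rw [map_mul, Module.End.mul_apply, LieModule.lowerCentralSeries_succ]
      exact LieSubmodule.envelopingAction_mem_lie _ ha (ih hb)
    | add u _ v _ hu hv =>
      rw [map_add, LinearMap.add_apply]
      exact add_mem hu hv

/-- If `x ∈ δ_n(L)`, then `x` maps every Lie module `M` into the `n`-th term of its lower central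
series. -/
theorem lie_mem_lowerCentralSeries_of_mem_lieDimensionSubring {n : ℕ} {x : L}
    (hx : x ∈ lieDimensionSubring R L n) (m : M) :
    ⁅x, m⁆ ∈ LieModule.lowerCentralSeries R L M n := by
  rw [← LieModule.envelopingAction_ι R]
  exact LieModule.envelopingAction_mem_lowerCentralSeries n hx m

theorem ι_mem_lieAugmentationIdeal (x : L) :
    UniversalEnvelopingAlgebra.ι R x ∈ lieAugmentationIdeal R L :=
  TwoSidedIdeal.mem_asIdeal.2 (TwoSidedIdeal.subset_span ⟨x, rfl⟩)

variable (R L)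

theorem lowerCentralSeries_le_lieDimensionSubring (n : ℕ) :
    LieModule.lowerCentralSeries R L L n ≤ lieDimensionSubring R L (n + 1) := by
  induction n with
  | zero =>
    intro x _
    change UniversalEnvelopingAlgebra.ι R x ∈ lieAugmentationIdeal R L ^ 1
    rw [Submodule.pow_one]
    exact ι_mem_lieAugmentationIdeal x
  | succ n ih =>
    rw [LieModule.lowerCentralSeries_succ, LieSubmodule.lie_le_iff]
    intro x _ y hy
    have hx := ι_mem_lieAugmentationIdeal (R := R) x
    have hy : UniversalEnvelopingAlgebra.ι R y ∈ lieAugmentationIdeal R L ^ (n + 1) := ih hy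
    change UniversalEnvelopingAlgebra.ι R ⁅x, y⁆ ∈ lieAugmentationIdeal R L ^ (n + 1 + 1)
    rw [LieHom.map_lie, LieRing.of_associative_ring_bracket]
    refine sub_mem ?_ ?_
    · rw [Ideal.IsTwoSided.pow_succ]
      exact Ideal.mul_mem_mul hx hy
    · rw [Submodule.pow_succ]
      exact Ideal.mul_mem_mul hy hx

theorem lieDimensionSubring_antitone : Antitone (lieDimensionSubring R L) :=
  fun _ _ h _ hx ↦ Ideal.pow_le_pow_right h hx

/-- The case `M = L`; `lieGamma` at `n + 1` is by definition the zero-based `lowerCentralSeries` at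
`n`. -/
theorem lieDimensionSubring_lie_top_le (n : ℕ) :
    ⁅lieDimensionSubring R L n, (⊤ : LieIdeal R L)⁆ ≤ lieGamma R L (n + 1) :=
  (LieSubmodule.lie_le_iff ..).2 fun _ hx y _ ↦
    lie_mem_lowerCentralSeries_of_mem_lieDimensionSubring hx y

end

theorem mainTheorem9 (L : Type*) [LieRing L] :
    ⁅lieDimensionSubring ℤ L 4, (⊤ : LieIdeal ℤ L)⁆ ≤
        lieGamma ℤ L 5 ⊔ LieAlgebra.derivedSeries ℤ L 2 ∧
      (LieAlgebra.derivedSeries ℤ L 2 = ⊥ →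
        lieGamma ℤ L 5 ≤ lieDimensionSubring ℤ L 4 ∧
        ∀ x ∈ lieDimensionSubring ℤ L 4,
          (LieSubmodule.Quotient.mk x : L ⧸ lieGamma ℤ L 5) ∈
            LieAlgebra.center ℤ (L ⧸ lieGamma ℤ L 5)) := by
  refine ⟨(lieDimensionSubring_lie_top_le ℤ L 4).trans le_sup_left, fun _ ↦ ⟨?_, ?_⟩⟩
  -- $\gamma_5(L)\subseteq\delta_5(L)\subseteq\delta_4(L)$.
  · exact (lowerCentralSeries_le_lieDimensionSubring ℤ L 4).trans
      (lieDimensionSubring_antitone ℤ L (by norm_num))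
  · intro x hx
    rw [LieModule.mem_maxTrivSubmodule]
    intro y
    obtain ⟨y, rfl⟩ := LieSubmodule.Quotient.surjective_mk' _ y
    rw [LieSubmodule.Quotient.mk'_apply, ← LieSubmodule.Quotient.mk_bracket,
      LieSubmodule.Quotient.mk_eq_zero', ← lie_skew]
    exact neg_mem (lieDimensionSubring_lie_top_le ℤ L 4
      (LieSubmodule.lie_mem_lie hx (LieSubmodule.mem_top y)))
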